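/- Fix an integer $m\ge 0$. For positive integers $k$, a $(\tfrac12,\tfrac12;k)$-comb is a tile consisting of $k$ teeth of width $\tfrac12$ (and height $1$), consecutive teeth being separated by gaps of width $\tfrac12$; a $(\tfrac12,\tfrac12;1)$-comb is called a half-square. A metatile of length $l\ge1$ is a non-overlapping arrangement of tiles that exactly covers $l$ consecutive unit cells and that cannot be split, at a boundary between two of these cells, into two arrangements of tiles each exactly covering the cells on its side. A metatile is mixed if it contains more than one type of tile. Let $\mu_l^{(1,m+2)}$ be the number of mixed metatiles of length $l$ (placed on cells $1,\dots,l$) when tiling with half-squares and $(\tfrac12,\tfrac12;m+2)$-combs. For a set $W$ of integers and $n\ge 0$, let $P_n^W$ be the permanent of the $n\times n$ matrix whose $(i,j)$ entry is $1$ if $j-i\in W$ and $0$ otherwise; equivalently, $P_n^W$ is the number of permutations $\pi$ of $\{1,\dots,n\}$ with $\pi(i)-i\in W$ for all $i$. Then for all integers $m\ge0$ and $l>1$, $$\mu_l^{(1,m+2)}=2\,P_{l-1}^{\{-2,-1,m\}}.$$ -/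

import Mathlib

/-- The part of the line occupied by a `(w, g; m)`-comb whose left end is at `x`: `m` teeth of
width `w`, consecutive teeth being separated by a gap of width `g`. All tiles and boards have
height `1`, so only the horizontal coordinate matters; half-open intervals are used so that
pieces which merely touch are disjoint. -/
def combRegion (w g : ℝ) (m : ℕ) (x : ℝ) : Set ℝ :=
  ⋃ j : Fin m, Set.Ico (x + (j : ℕ) * (w + g)) (x + (j : ℕ) * (w + g) + w)

/-- A placed `(1/2, 1/2; teeth)`-comb: its type, i.e. its number of teeth (a comb with one tooth
is a half-square), and the position of its left end. -/
@[ext] structure PlacedComb where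
  teeth : ℕ
  pos : ℝ

/-- The part of the line covered by the teeth of a placed comb. -/
def PlacedComb.region (p : PlacedComb) : Set ℝ :=
  combRegion (1 / 2) (1 / 2) p.teeth p.pos

/-- `T` is a tiling of the cells from `a` to `b` (the interval `[a, b)`) using
`(1/2, 1/2; m₁)`-combs and `(1/2, 1/2; m₂)`-combs: the tiles do not overlap and together they
cover precisely these cells. -/
structure IsCombTiling (m₁ m₂ : ℕ) (a b : ℕ) (T : Set PlacedComb) : Prop where
  finite : T.Finite
  teeth_mem : ∀ p ∈ T, p.teeth = m₁ ∨ p.teeth = m₂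
  disjoint : ∀ p ∈ T, ∀ q ∈ T, p ≠ q → Disjoint p.region q.region
  cover : ⋃ p ∈ T, p.region = Set.Ico (a : ℝ) (b : ℝ)

/-- `T` is a metatile of length `l` (placed with its left end at `0`): a grouping of tiles that
exactly covers `l ≥ 1` cells and cannot be split, at a cell boundary `k` with `0 < k < l`, into
two groupings that exactly cover the cells before `k` and the cells after `k`. -/
structure IsMetatile (m₁ m₂ : ℕ) (l : ℕ) (T : Set PlacedComb) : Prop where
  pos : 0 < l
  tiling : IsCombTiling m₁ m₂ 0 l T
  not_split : ¬ ∃ k : ℕ, 0 < k ∧ k < l ∧ ∃ S ⊆ T,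
    IsCombTiling m₁ m₂ 0 k S ∧ IsCombTiling m₁ m₂ k l (T \ S)

/-- A mixed metatile is a metatile that contains more than one type of tile. -/
def IsMixedMetatile (m₁ m₂ : ℕ) (l : ℕ) (T : Set PlacedComb) : Prop :=
  IsMetatile m₁ m₂ l T ∧ ∃ p ∈ T, ∃ q ∈ T, p.teeth ≠ q.teeth

/-- The number of mixed metatiles of length `l` when tiling with `(1/2, 1/2; m₁)`-combs and
`(1/2, 1/2; m₂)`-combs (an extended natural number, so that no finiteness is presupposed). -/
noncomputable def numMixedMetatiles (m₁ m₂ : ℕ) (l : ℕ) : ℕ∞ :=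
  {T : Set PlacedComb | IsMixedMetatile m₁ m₂ l T}.encard

/-- The number of strongly restricted permutations `π` of an `n`-element initial segment such
that `π i - i ∈ W` for every `i`. -/
noncomputable def numRestrictedPerms (n : ℕ) (W : Set ℤ) : ℕ :=
  Nat.card {π : Equiv.Perm (Fin n) // ∀ i : Fin n, ((π i : ℕ) : ℤ) - ((i : ℕ) : ℤ) ∈ W}

open Classical in
/-- The `n × n` `(0,1)` Toeplitz matrix whose `(i, j)` entry is `1` iff `j - i ∈ W`. -/
noncomputable def toeplitz01 (n : ℕ) (W : Set ℤ) : Matrix (Fin n) (Fin n) ℕ :=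
  Matrix.of fun i j => if ((j : ℕ) : ℤ) - ((i : ℕ) : ℤ) ∈ W then 1 else 0

/-! Both sides are counted through one kind of finite set, `IsExcedanceSet`. A tiling is determined
by the left ends of its long combs, measured in half cells, since half-squares fill the rest. It
fails to split at a boundary exactly when a long comb straddles it. In a mixed metatile no cell
holds two left ends: two interlocked combs would already be a whole metatile, with no half-square.
So the left ends are given by the set `E` of their cells and a choice of half in each. Consecutive
combs must use opposite halves, so only the half of the first comb is free: this is the factor 2
(`encard_isStaggered`). Straddling says that every window of `m + 1` cells `j - m, ..., j` meets
`E`; disjointness says that three elements of `E` span at least `m + 2`, because two of the three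
combs share a parity. The positions of displacement `m` of a permutation satisfy the same two
conditions, by pigeonhole. Conversely they determine the permutation: another position `i` moves
down by 2 when two elements `s < t < i` of `E` satisfy `i ≤ s + m + 1`, and by 1 otherwise
(`excedances_inj`, `exists_perm`). -/

/-! ### Permutations with displacements -2, -1, m and their excedance sets. -/

/-- The sets of positions `i` with `π i = i + m` of the permutations `π` of an `n`-element
initial segment all of whose other displacements are `-1` or `-2`. -/
structure IsExcedanceSet (m n : ℕ) (E : Set ℕ) : Prop where
  add_lt : ∀ s ∈ E, s + m < n
  exists_mem : ∀ j < n, ∃ s ∈ E, s ≤ j ∧ j ≤ s + m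
  sparse : ∀ s ∈ E, ∀ t ∈ E, ∀ u ∈ E, s < t → t < u → s + m + 2 ≤ u

/-- The positions of displacement `m` of a permutation. -/
def excedances (m : ℕ) {n : ℕ} (π : Equiv.Perm (Fin n)) : Set ℕ :=
  {i | ∃ x : Fin n, (x : ℕ) = i ∧ (π x : ℕ) = i + m}

theorem displacement_iff {m n : ℕ} {π : Equiv.Perm (Fin n)} :
    (∀ i : Fin n, ((π i : ℕ) : ℤ) - ((i : ℕ) : ℤ) ∈ ({-2, -1, (m : ℤ)} : Set ℤ)) ↔
      ∀ i : Fin n, (π i : ℕ) + 2 = i ∨ (π i : ℕ) + 1 = i ∨ (π i : ℕ) = i + m := by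
  refine forall_congr' fun i => ?_
  simp only [Set.mem_insert_iff, Set.mem_singleton_iff]
  omega

theorem isExcedanceSet_excedances {m n : ℕ} {π : Equiv.Perm (Fin n)}
    (hπ : ∀ i : Fin n, (π i : ℕ) + 2 = i ∨ (π i : ℕ) + 1 = i ∨ (π i : ℕ) = i + m) :
    IsExcedanceSet m n (excedances m π) where
  add_lt := by
    rintro s ⟨x, rfl, hx⟩
    have := (π x).2
    omega
  exists_mem := by
    intro j hj
    by_contra! h
    -- If no upward jump from a position up to `j` reaches `j`, then `j + 1` positions are injected
    -- into `j` values.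
    have hmaps : ∀ x ∈ Finset.Iic (⟨j, hj⟩ : Fin n), π x ∈ Finset.Iio (⟨j, hj⟩ : Fin n) := by
      intro x hx
      simp only [Finset.mem_Iic, Finset.mem_Iio, Fin.le_def, Fin.lt_def] at hx ⊢
      rcases hπ x with h1 | h1 | h1
      · omega
      · omega
      · have := h x ⟨x, rfl, h1⟩ hx
        omega
    have := Finset.card_le_card_of_injOn π hmaps π.injective.injOn
    simp only [Fin.card_Iic, Fin.card_Iio] at this
    omega
  sparse := by
    rintro _ ⟨s, rfl, hs⟩ _ ⟨t, rfl, ht⟩ _ ⟨u, rfl, hu⟩ hst htu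
    by_contra! hlt
    have hn := u.2
    let j : Fin n := ⟨u - 1, by omega⟩
    have hj : (j : ℕ) = u - 1 := rfl
    -- The `u - 1` values below `u - 1` come from positions at most `u`. The position `u` moves
    -- weakly up, and `s`, `t` jump to `u - 1` or beyond, so only `u - 2` positions remain.
    have hmaps : ∀ v ∈ Finset.Iio j, π.symm v ∈ ((Finset.Iic j).erase s).erase t := by
      intro v hv
      obtain ⟨x, rfl⟩ := π.surjective v
      simp only [Equiv.symm_apply_apply, Finset.mem_erase, Finset.mem_Iic, Finset.mem_Iio,
        Fin.le_def, Fin.lt_def] at hv ⊢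
      refine ⟨?_, ?_, ?_⟩
      · rintro rfl; omega
      · rintro rfl; omega
      · have hxu : (x : ℕ) ≠ u := fun h => by
          obtain rfl := Fin.ext h
          omega
        rcases hπ x with h1 | h1 | h1 <;> omega
    have := Finset.card_le_card_of_injOn π.symm hmaps π.symm.injective.injOn
    rw [Finset.card_erase_of_mem, Finset.card_erase_of_mem, Fin.card_Iic, Fin.card_Iio] at this
    · omega
    · simp only [Finset.mem_Iic, Fin.le_def]; omega
    · simp only [Finset.mem_Iic, Finset.mem_erase, Fin.le_def, ne_eq, Fin.ext_iff]; omega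

/-- At the first disagreement `i`, one permutation takes the value `i - 1` and the other `i - 2`.
The first must reach `i - 2` from a position below `i`, where the two agree, so the second would
take that value twice. -/
theorem excedances_inj {m n : ℕ} {π σ : Equiv.Perm (Fin n)}
    (hπ : ∀ i : Fin n, (π i : ℕ) + 2 = i ∨ (π i : ℕ) + 1 = i ∨ (π i : ℕ) = i + m)
    (hσ : ∀ i : Fin n, (σ i : ℕ) + 2 = i ∨ (σ i : ℕ) + 1 = i ∨ (σ i : ℕ) = i + m)
    (h : excedances m π = excedances m σ) : π = σ := by
  have key : ∀ (π σ : Equiv.Perm (Fin n)),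
      (∀ i : Fin n, (π i : ℕ) + 2 = i ∨ (π i : ℕ) + 1 = i ∨ (π i : ℕ) = i + m) →
      ∀ i : Fin n, (∀ j < i, π j = σ j) → (π i : ℕ) + 1 = i → (σ i : ℕ) + 2 = i → False := by
    intro π σ hπ i ih h1 h2
    obtain ⟨x, hx⟩ := π.surjective (σ i)
    have hne : x ≠ i := by
      rintro rfl
      rw [hx] at h1
      omega
    have hne' : (x : ℕ) ≠ i := fun h => hne (Fin.ext h)
    have hlt : x < i := by
      rw [Fin.lt_def]
      rcases hπ x with h3 | h3 | h3 <;> rw [hx] at h3 <;> omega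
    exact hne (σ.injective ((ih x hlt).symm.trans hx))
  have hmem : ∀ i : Fin n, (π i : ℕ) = i + m ↔ (σ i : ℕ) = i + m := by
    intro i
    have h1 := Set.ext_iff.1 h i
    constructor
    · intro h2
      obtain ⟨x, hx, h3⟩ := h1.1 ⟨i, rfl, h2⟩
      obtain rfl := Fin.ext hx
      exact h3
    · intro h2
      obtain ⟨x, hx, h3⟩ := h1.2 ⟨i, rfl, h2⟩
      obtain rfl := Fin.ext hx
      exact h3
  ext1 i
  induction i using WellFoundedLT.induction with
  | ind i ih =>
    have hi := hmem i
    have k1 := key π σ hπ i ih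
    have k2 := key σ π hσ i fun j hj => (ih j hj).symm
    ext
    rcases hπ i with h1 | h1 | h1 <;> rcases hσ i with h2 | h2 | h2 <;> first | omega | tauto

open Classical in
/-- The permutation with a given set of positions of displacement `m`, as a function on `ℕ`. -/
noncomputable def shiftOfExcedances (m : ℕ) (E : Set ℕ) (i : ℕ) : ℕ :=
  if i ∈ E then i + m
  else if ∃ s ∈ E, ∃ t ∈ E, s < t ∧ t < i ∧ i ≤ s + m + 1 then i - 2 else i - 1

namespace IsExcedanceSet

variable {m n : ℕ} {E : Set ℕ}

/-- The truncated subtractions are genuine: `s < t < i` forces `2 ≤ i`, and `exists_mem` forces `1 ≤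
i` when `i ∉ E`. -/
theorem shift_cases (hE : IsExcedanceSet m n E) {i : ℕ} (hi : i < n) :
    (i ∈ E ∧ shiftOfExcedances m E i = i + m) ∨
    (i ∉ E ∧ (∃ s ∈ E, ∃ t ∈ E, s < t ∧ t < i ∧ i ≤ s + m + 1) ∧
      shiftOfExcedances m E i + 2 = i) ∨
    (i ∉ E ∧ (¬ ∃ s ∈ E, ∃ t ∈ E, s < t ∧ t < i ∧ i ≤ s + m + 1) ∧
      shiftOfExcedances m E i + 1 = i) := by
  unfold shiftOfExcedances
  by_cases h : i ∈ E
  · simp [h]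
  · by_cases h2 : ∃ s ∈ E, ∃ t ∈ E, s < t ∧ t < i ∧ i ≤ s + m + 1
    · refine Or.inr (Or.inl ⟨h, h2, ?_⟩)
      rw [if_neg h, if_pos h2]
      obtain ⟨s, _, t, _, h3⟩ := h2
      omega
    · refine Or.inr (Or.inr ⟨h, h2, ?_⟩)
      rw [if_neg h, if_neg h2]
      obtain ⟨s, hs, h3, _⟩ := hE.exists_mem i hi
      have : s ≠ i := fun h4 => h (h4 ▸ hs)
      omega

theorem shift_lt (hE : IsExcedanceSet m n E) {i : ℕ} (hi : i < n) :
    shiftOfExcedances m E i < n := by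
  rcases hE.shift_cases hi with ⟨h, h1⟩ | ⟨h, -, h1⟩ | ⟨h, -, h1⟩
  · have := hE.add_lt i h
    omega
  · omega
  · omega

theorem shift_inj (hE : IsExcedanceSet m n E) {i j : ℕ} (hi : i < n) (hj : j < n)
    (h : shiftOfExcedances m E i = shiftOfExcedances m E j) : i = j := by
  -- Collisions are excluded by type: displacement `m` against -1 by `exists_mem`, `m` against -2 by
  -- `sparse`, and -1 against -2 because a pair forcing -2 at `i + 1` also forces it at `i`.
  have up_one : ∀ {i j : ℕ}, j < n → i ∈ E → j ∉ E →
      (¬ ∃ s ∈ E, ∃ t ∈ E, s < t ∧ t < j ∧ j ≤ s + m + 1) → j = i + m + 1 → False := by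
    rintro i j hj hi hjE h rfl
    obtain ⟨t, ht, h1, h2⟩ := hE.exists_mem _ hj
    have : t ≠ i + m + 1 := fun h4 => hjE (h4 ▸ ht)
    exact h ⟨i, hi, t, ht, by omega, by omega, by omega⟩
  have up_two : ∀ {i j : ℕ}, i ∈ E →
      (∃ s ∈ E, ∃ t ∈ E, s < t ∧ t < j ∧ j ≤ s + m + 1) → j = i + m + 2 → False := by
    rintro i j hi ⟨s, hs, t, ht, h1, h2, h3⟩ rfl
    have := hE.sparse i hi s hs t ht (by omega) h1
    omega
  have down : ∀ {i j : ℕ}, i ∉ E →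
      (¬ ∃ s ∈ E, ∃ t ∈ E, s < t ∧ t < i ∧ i ≤ s + m + 1) →
      (∃ s ∈ E, ∃ t ∈ E, s < t ∧ t < j ∧ j ≤ s + m + 1) → j = i + 1 → False := by
    rintro i j hi h ⟨s, hs, t, ht, h1, h2, h3⟩ rfl
    have : t ≠ i := fun h4 => hi (h4 ▸ ht)
    exact h ⟨s, hs, t, ht, h1, by omega, by omega⟩
  rcases hE.shift_cases hi with ⟨a, b⟩ | ⟨a, b, c⟩ | ⟨a, b, c⟩ <;>
    rcases hE.shift_cases hj with ⟨a', b'⟩ | ⟨a', b', c'⟩ | ⟨a', b', c'⟩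
  · omega
  · exact (up_two a b' (by omega)).elim
  · exact (up_one hj a a' b' (by omega)).elim
  · exact (up_two a' b (by omega)).elim
  · omega
  · exact (down a' b' b (by omega)).elim
  · exact (up_one hi a' a b (by omega)).elim
  · exact (down a b b' (by omega)).elim
  · omega

theorem exists_perm (hE : IsExcedanceSet m n E) :
    ∃ π : Equiv.Perm (Fin n),
      (∀ i : Fin n, (π i : ℕ) + 2 = i ∨ (π i : ℕ) + 1 = i ∨ (π i : ℕ) = i + m) ∧
        excedances m π = E := by
  let f : Fin n → Fin n := fun i => ⟨shiftOfExcedances m E i, hE.shift_lt i.2⟩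
  have hf : Function.Injective f := fun i j h =>
    Fin.ext (hE.shift_inj i.2 j.2 (Fin.mk.inj_iff.1 h))
  refine ⟨Equiv.ofBijective f (Finite.injective_iff_bijective.1 hf), fun i => ?_, ?_⟩
  · simp only [Equiv.ofBijective_apply, f]
    rcases hE.shift_cases i.2 with ⟨a, b⟩ | ⟨a, b, c⟩ | ⟨a, b, c⟩ <;> omega
  · ext i
    simp only [excedances, Equiv.ofBijective_apply, f, Set.mem_ofPred_eq]
    constructor
    · rintro ⟨x, rfl, hx⟩
      rcases hE.shift_cases x.2 with ⟨a, b⟩ | ⟨a, b, c⟩ | ⟨a, b, c⟩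
      · exact a
      · omega
      · omega
    · intro hi
      have := hE.add_lt i hi
      refine ⟨⟨i, by omega⟩, rfl, ?_⟩
      simp [shiftOfExcedances, hi]

end IsExcedanceSet

theorem encard_isExcedanceSet (m n : ℕ) :
    {E | IsExcedanceSet m n E}.encard = (numRestrictedPerms n {-2, -1, (m : ℤ)} : ℕ∞) := by
  have himage : {E | IsExcedanceSet m n E} = excedances m '' {π : Equiv.Perm (Fin n) |
      ∀ i : Fin n, ((π i : ℕ) : ℤ) - ((i : ℕ) : ℤ) ∈ ({-2, -1, (m : ℤ)} : Set ℤ)} := by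
    ext E
    constructor
    · intro hE
      obtain ⟨π, h1, h2⟩ := IsExcedanceSet.exists_perm hE
      exact ⟨π, displacement_iff.2 h1, h2⟩
    · rintro ⟨π, h1, rfl⟩
      exact isExcedanceSet_excedances (displacement_iff.1 h1)
  rw [himage, Set.InjOn.encard_image]
  · rw [← (Set.toFinite _).cast_ncard_eq]
    rfl
  · intro π hπ σ hσ h
    exact excedances_inj (displacement_iff.1 hπ) (displacement_iff.1 hσ) h

theorem permanent_toeplitz01 (n : ℕ) (W : Set ℤ) :
    (toeplitz01 n W).permanent = numRestrictedPerms n W := by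
  classical
  -- The permanent multiplies the entries `(σ i, i)`; transposing makes the condition one on `σ i -
  -- i`.
  rw [← Matrix.permanent_transpose, Matrix.permanent, numRestrictedPerms, Nat.card_eq_fintype_card,
    Fintype.card_subtype, Finset.card_filter]
  refine Finset.sum_congr rfl fun σ _ => ?_
  simp only [toeplitz01, Matrix.transpose_apply, Matrix.of_apply]
  rw [Finset.prod_ite_zero]
  simp

/-! ### Staggered sets of left ends and the two-to-one map onto excedance sets. -/

/-- The sets of left ends, in half cells, of the long combs of a mixed metatile. -/
structure IsStaggered (m l : ℕ) (C : Set ℕ) : Prop where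
  fits : ∀ k ∈ C, k + 2 * m + 2 < 2 * l
  apart : ∀ k ∈ C, ∀ k' ∈ C, k < k' → k % 2 = k' % 2 → k + 2 * m + 4 ≤ k'
  straddled : ∀ j, 0 < j → j < l → ∃ k ∈ C, k < 2 * j ∧ 2 * j ≤ k + 2 * m + 2
  not_both : ∀ s, 2 * s ∈ C → 2 * s + 1 ∉ C

/-- The cells containing the left ends listed, in half cells, in a set. -/
def cellsOf (C : Set ℕ) : Set ℕ := {s | 2 * s ∈ C ∨ 2 * s + 1 ∈ C}

theorem half_mem_cellsOf {C : Set ℕ} {k : ℕ} (h : k ∈ C) : k / 2 ∈ cellsOf C := by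
  rcases Nat.mod_two_eq_zero_or_one k with h0 | h0
  · left
    rwa [show 2 * (k / 2) = k by omega]
  · right
    rwa [show 2 * (k / 2) + 1 = k by omega]

theorem exists_mem_of_mem_cellsOf {C : Set ℕ} {s : ℕ} (h : s ∈ cellsOf C) :
    ∃ k ∈ C, k / 2 = s := by
  rcases h with h | h
  · exact ⟨_, h, by omega⟩
  · exact ⟨_, h, by omega⟩

theorem IsStaggered.isExcedanceSet {m l : ℕ} {C : Set ℕ} (hC : IsStaggered m l C) :
    IsExcedanceSet m (l - 1) (cellsOf C) where
  add_lt := by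
    intro s hs
    obtain ⟨k, hk, rfl⟩ := exists_mem_of_mem_cellsOf hs
    have := hC.fits k hk
    omega
  exists_mem := by
    intro j hj
    obtain ⟨k, hk, h1, h2⟩ := hC.straddled (j + 1) (by omega) (by omega)
    exact ⟨k / 2, half_mem_cellsOf hk, by omega, by omega⟩
  sparse := by
    intro s hs t ht u hu hst htu
    obtain ⟨k, hk, rfl⟩ := exists_mem_of_mem_cellsOf hs
    obtain ⟨k', hk', rfl⟩ := exists_mem_of_mem_cellsOf ht
    obtain ⟨k'', hk'', rfl⟩ := exists_mem_of_mem_cellsOf hu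
    -- Among three left ends two have equal parity, hence are `2 * m + 4` half cells apart.
    have h1 := hC.apart k hk k' hk' (by omega)
    have h2 := hC.apart k' hk' k'' hk'' (by omega)
    have h3 := hC.apart k hk k'' hk'' (by omega)
    omega

/-- Adjacent combs of a staggered set have opposite parities, so the cells and the parity of the
first comb determine the set. -/
theorem IsStaggered.eq_of_cellsOf_eq {m l : ℕ} {C D : Set ℕ} (hC : IsStaggered m l C)
    (hD : IsStaggered m l D) (h : cellsOf C = cellsOf D) (h0 : 0 ∈ C ↔ 0 ∈ D) : C = D := by
  have key : ∀ s ∈ cellsOf C, (2 * s ∈ C ↔ 2 * s ∈ D) := by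
    intro s
    induction s using Nat.strong_induction_on with
    | _ s ih =>
      intro hs
      rcases Nat.eq_zero_or_pos s with rfl | hpos
      · exact h0
      have hsl := hC.isExcedanceSet.add_lt s hs
      -- The comb starting in cell `t` straddles the boundary just before `s`; it is too close to
      -- the comb in `s` to share its parity.
      obtain ⟨t, ht, h1, h2⟩ := hC.isExcedanceSet.exists_mem (s - 1) (by omega)
      have opp : ∀ {B : Set ℕ}, IsStaggered m l B → s ∈ cellsOf B → t ∈ cellsOf B →
          (2 * s ∈ B ↔ 2 * t ∉ B) := by
        intro B hB hs ht
        constructor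
        · intro h3 h4
          have := hB.apart _ h4 _ h3 (by omega) (by omega)
          omega
        · intro h4
          rcases hs with h5 | h5
          · exact h5
          · rcases ht with h6 | h6
            · exact absurd h6 h4
            · have := hB.apart _ h6 _ h5 (by omega) (by omega)
              omega
      rw [opp hC hs ht, opp hD (h ▸ hs) (h ▸ ht), ih t (by omega) ht]
  have sub : ∀ {C D : Set ℕ}, IsStaggered m l C → cellsOf C = cellsOf D →
      (∀ s ∈ cellsOf C, (2 * s ∈ C ↔ 2 * s ∈ D)) → C ⊆ D := by
    intro C D hC h key k hk
    have hs := half_mem_cellsOf hk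
    have h1 := key _ hs
    rcases Nat.mod_two_eq_zero_or_one k with h2 | h2
    · rw [show 2 * (k / 2) = k by omega] at h1
      exact h1.1 hk
    · have h3 : 2 * (k / 2) + 1 = k := by omega
      have h4 : 2 * (k / 2) ∉ C := fun h5 => hC.not_both _ h5 (h3.symm ▸ hk)
      rw [h] at hs
      rcases hs with h5 | h5
      · exact absurd (h1.2 h5) h4
      · rwa [h3] at h5
  exact (sub hC h key).antisymm (sub hD h.symm fun s hs => (key s (h ▸ hs)).symm)

open Classical in
/-- The half cells obtained from a set of cells by alternating between the two halves, starting
with half `b`. -/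
noncomputable def alternate (b : ℕ) (E : Set ℕ) : Set ℕ :=
  {k | k / 2 ∈ E ∧ k % 2 = (b + Nat.count (· ∈ E) (k / 2)) % 2}

theorem cellsOf_alternate (b : ℕ) (E : Set ℕ) : cellsOf (alternate b E) = E := by
  classical
  ext s
  simp only [cellsOf, alternate, Set.mem_ofPred_eq, show 2 * s / 2 = s by omega,
    show (2 * s + 1) / 2 = s by omega]
  constructor
  · rintro (h | h) <;> exact h.1
  · intro h
    rcases Nat.mod_two_eq_zero_or_one (b + Nat.count (· ∈ E) s) with h1 | h1
    · exact Or.inl ⟨h, by omega⟩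
    · exact Or.inr ⟨h, by omega⟩

theorem IsExcedanceSet.isStaggered_alternate {m l : ℕ} {E : Set ℕ} (b : ℕ)
    (hE : IsExcedanceSet m (l - 1) E) : IsStaggered m l (alternate b E) where
  fits := by
    intro k hk
    have := hE.add_lt _ hk.1
    omega
  apart := by
    classical
    rintro k ⟨hk, hb⟩ k' ⟨hk', hb'⟩ hlt hpar
    have hlt2 : k / 2 < k' / 2 := by omega
    have h1 : Nat.count (· ∈ E) (k / 2) < Nat.count (· ∈ E) (k' / 2) :=
      Nat.count_strict_mono hk hlt2
    have h2 : Nat.count (· ∈ E) (k / 2 + 1) = Nat.count (· ∈ E) (k / 2) + 1 := by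
      rw [Nat.count_succ, if_pos hk]
    -- Consecutive cells of `E` get opposite halves, so two cells with the same half have a third
    -- between them, and `sparse` applies.
    have h3 : ∃ u ∈ E, k / 2 < u ∧ u < k' / 2 := by
      by_contra! hno
      have h4 : Nat.count (· ∈ E) (k' / 2) = Nat.count (· ∈ E) (k / 2 + 1) := by
        obtain ⟨d, hd⟩ := Nat.exists_eq_add_of_le (show k / 2 + 1 ≤ k' / 2 by omega)
        rw [hd, Nat.count_add, Nat.add_eq_left, Nat.count_iff_forall_not]
        intro i hi hmem
        have := hno _ hmem (by omega)
        omega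
      have hb1 : k % 2 = (b + Nat.count (· ∈ E) (k / 2)) % 2 := by convert hb
      have hb2 : k' % 2 = (b + Nat.count (· ∈ E) (k' / 2)) % 2 := by convert hb'
      omega
    obtain ⟨u, hu, h4, h5⟩ := h3
    have := hE.sparse _ hk u hu _ hk' h4 h5
    omega
  straddled := by
    intro j h0 hj
    obtain ⟨s, hs, h1, h2⟩ := hE.exists_mem (j - 1) (by omega)
    rw [← cellsOf_alternate b E] at hs
    obtain ⟨k, hk, rfl⟩ := exists_mem_of_mem_cellsOf hs
    exact ⟨k, hk, by omega, by omega⟩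
  not_both := by
    rintro s ⟨-, h1⟩ ⟨-, h2⟩
    rw [show 2 * s / 2 = s by omega] at h1
    rw [show (2 * s + 1) / 2 = s by omega] at h2
    omega

theorem IsExcedanceSet.zero_mem {m n : ℕ} {E : Set ℕ} (hE : IsExcedanceSet m n E) (hn : 0 < n) :
    0 ∈ E := by
  obtain ⟨s, hs, h, -⟩ := hE.exists_mem 0 hn
  rwa [Nat.le_zero.1 h] at hs

theorem IsExcedanceSet.zero_mem_alternate {m n : ℕ} {E : Set ℕ} (hE : IsExcedanceSet m n E)
    (hn : 0 < n) (b : ℕ) : 0 ∈ alternate b E ↔ b % 2 = 0 := by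
  have := hE.zero_mem hn
  simp [alternate, this, eq_comm]

theorem encard_isStaggered (m l : ℕ) (hl : 1 < l) :
    {C | IsStaggered m l C}.encard = 2 * {E | IsExcedanceSet m (l - 1) E}.encard := by
  have half : ∀ b : ℕ, {C | IsStaggered m l C ∧ (0 ∈ C ↔ b % 2 = 0)}.encard =
      {E | IsExcedanceSet m (l - 1) E}.encard := by
    intro b
    have himage : {E | IsExcedanceSet m (l - 1) E} =
        cellsOf '' {C | IsStaggered m l C ∧ (0 ∈ C ↔ b % 2 = 0)} := by
      ext E
      constructor
      · intro hE
        exact ⟨alternate b E, ⟨hE.isStaggered_alternate b, hE.zero_mem_alternate (by omega) b⟩,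
          cellsOf_alternate b E⟩
      · rintro ⟨C, ⟨hC, -⟩, rfl⟩
        exact hC.isExcedanceSet
    rw [himage, Set.InjOn.encard_image]
    rintro C ⟨hC, hC0⟩ D ⟨hD, hD0⟩ h
    exact hC.eq_of_cellsOf_eq hD h (hC0.trans hD0.symm)
  -- Some comb starts in cell 0; the two classes record whether it starts in the left or the right
  -- half.
  have hunion : {C | IsStaggered m l C} = {C | IsStaggered m l C ∧ (0 ∈ C ↔ 0 % 2 = 0)} ∪
      {C | IsStaggered m l C ∧ (0 ∈ C ↔ 1 % 2 = 0)} := by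
    ext C
    simp only [Set.mem_union, Set.mem_ofPred_eq]
    by_cases h : 0 ∈ C <;> simp [h]
  rw [hunion, Set.encard_union_eq, half, half, two_mul]
  rw [Set.disjoint_left]
  rintro C ⟨-, h1⟩ ⟨-, h2⟩
  simp only [Nat.zero_mod, iff_true] at h1
  have := h2.1 h1
  omega

/-! ### Reduction from real positions to half cells. -/

/-- The comb with `p.1` teeth whose left end is `p.2` half cells from the origin. -/
noncomputable def combOfSlot (p : ℕ × ℕ) : PlacedComb := ⟨p.1, p.2 / 2⟩

/-- The comb with `p.1` teeth and left end at half cell `p.2` covers half cell `i`. -/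
def SlotCovers (p : ℕ × ℕ) (i : ℕ) : Prop := ∃ j < p.1, i = p.2 + 2 * j

theorem combOfSlot_injective : Function.Injective combOfSlot := by
  rintro ⟨t, k⟩ ⟨t', k'⟩ h
  simp only [combOfSlot, PlacedComb.mk.injEq] at h
  obtain ⟨rfl, h⟩ := h
  have : (k : ℝ) = k' := by linarith
  simpa using this

theorem PlacedComb.mem_region {p : PlacedComb} {x : ℝ} :
    x ∈ p.region ↔ ∃ j < p.teeth, p.pos + j ≤ x ∧ x < p.pos + j + 1 / 2 := by
  simp only [PlacedComb.region, combRegion, Set.mem_iUnion, Set.mem_Ico]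
  constructor
  · rintro ⟨j, h1, h2⟩
    exact ⟨j, j.2, by linarith, by linarith⟩
  · rintro ⟨j, hj, h1, h2⟩
    exact ⟨⟨j, hj⟩, by norm_num; linarith, by norm_num; linarith⟩

theorem mem_region_combOfSlot {p : ℕ × ℕ} {x : ℝ} :
    x ∈ (combOfSlot p).region ↔ 0 ≤ x ∧ SlotCovers p ⌊2 * x⌋₊ := by
  rw [PlacedComb.mem_region]
  simp only [combOfSlot, SlotCovers]
  constructor
  · rintro ⟨j, hj, h1, h2⟩
    have hx : 0 ≤ x := le_trans (by positivity) h1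
    refine ⟨hx, j, hj, ?_⟩
    rw [Nat.floor_eq_iff (by linarith)]
    push_cast
    exact ⟨by linarith, by linarith⟩
  · rintro ⟨hx, j, hj, h⟩
    rw [Nat.floor_eq_iff (by linarith)] at h
    push_cast at h
    exact ⟨j, hj, by linarith, by linarith⟩

theorem floor_two_mul_half (i : ℕ) : ⌊2 * ((i : ℝ) / 2)⌋₊ = i := by
  rw [mul_div_cancel₀ _ (two_ne_zero), Nat.floor_natCast]

theorem half_mem_region_combOfSlot {p : ℕ × ℕ} {i : ℕ} :
    (i : ℝ) / 2 ∈ (combOfSlot p).region ↔ SlotCovers p i := by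
  rw [mem_region_combOfSlot, floor_two_mul_half, and_iff_right (by positivity)]

/-- `S` is a tiling of the cells from `a` to `b` by half-squares and combs with `m + 2` teeth, all
of whose left ends are given in half cells. -/
structure IsSlotTiling (m a b : ℕ) (S : Set (ℕ × ℕ)) : Prop where
  teeth_mem : ∀ p ∈ S, p.1 = 1 ∨ p.1 = m + 2
  eq_of_covers : ∀ p ∈ S, ∀ q ∈ S, ∀ i, SlotCovers p i → SlotCovers q i → p = q
  cover : ∀ i, (∃ p ∈ S, SlotCovers p i) ↔ 2 * a ≤ i ∧ i < 2 * b

theorem slotCovers_self {p : ℕ × ℕ} (h : 0 < p.1) : SlotCovers p p.2 := ⟨0, h, rfl⟩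

namespace IsSlotTiling

variable {m a b : ℕ} {S : Set (ℕ × ℕ)}

theorem slotCovers_snd (hS : IsSlotTiling m a b S) {p : ℕ × ℕ} (hp : p ∈ S) :
    SlotCovers p p.2 :=
  slotCovers_self (by rcases hS.teeth_mem p hp with h | h <;> omega)

theorem finite (hS : IsSlotTiling m a b S) : S.Finite := by
  refine (((Set.finite_le_nat (m + 2)).prod (Set.finite_lt_nat (2 * b)))).subset fun p hp => ?_
  have h1 := (hS.cover p.2).1 ⟨p, hp, hS.slotCovers_snd hp⟩
  refine ⟨?_, h1.2⟩
  rcases hS.teeth_mem p hp with h | h <;> simp only [Set.mem_ofPred_eq] <;> omega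

end IsSlotTiling

theorem mem_Ico_iff_floor {a b : ℕ} {x : ℝ} :
    x ∈ Set.Ico (a : ℝ) b ↔ 0 ≤ x ∧ 2 * a ≤ ⌊2 * x⌋₊ ∧ ⌊2 * x⌋₊ < 2 * b := by
  rw [Set.mem_Ico]
  constructor
  · rintro ⟨h1, h2⟩
    have hx : 0 ≤ x := le_trans (by positivity) h1
    refine ⟨hx, Nat.le_floor (by push_cast; linarith), ?_⟩
    rw [Nat.floor_lt (by linarith)]
    push_cast
    linarith
  · rintro ⟨hx, h1, h2⟩
    rw [Nat.le_floor_iff (by linarith)] at h1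
    rw [Nat.floor_lt (by linarith)] at h2
    push_cast at h1 h2
    exact ⟨by linarith, by linarith⟩

/-- With left ends at half-integers every region is a union of half cells, so overlap and coverage
can be tested at the points `i / 2`. -/
theorem isCombTiling_image_iff {m a b : ℕ} {S : Set (ℕ × ℕ)} :
    IsCombTiling 1 (m + 2) a b (combOfSlot '' S) ↔ IsSlotTiling m a b S := by
  constructor
  · intro h
    refine ⟨fun p hp => h.teeth_mem _ ⟨p, hp, rfl⟩, fun p hp q hq i hpi hqi => ?_, fun i => ?_⟩
    · by_contra hne
      exact Set.disjoint_left.1 (h.disjoint _ ⟨p, hp, rfl⟩ _ ⟨q, hq, rfl⟩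
        fun h1 => hne (combOfSlot_injective h1)) (half_mem_region_combOfSlot.2 hpi)
        (half_mem_region_combOfSlot.2 hqi)
    · have h1 := Set.ext_iff.1 h.cover ((i : ℝ) / 2)
      rw [Set.biUnion_image, mem_Ico_iff_floor, floor_two_mul_half,
        and_iff_right (by positivity)] at h1
      simpa only [Set.mem_iUnion, half_mem_region_combOfSlot, exists_prop] using h1
  · intro h
    refine ⟨h.finite.image _, ?_, ?_, ?_⟩
    · rintro _ ⟨p, hp, rfl⟩
      exact h.teeth_mem p hp
    · rintro _ ⟨p, hp, rfl⟩ _ ⟨q, hq, rfl⟩ hne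
      rw [Set.disjoint_left]
      intro x hx hx'
      exact hne (congrArg _ (h.eq_of_covers p hp q hq _ (mem_region_combOfSlot.1 hx).2
        (mem_region_combOfSlot.1 hx').2))
    · ext x
      rw [Set.biUnion_image, mem_Ico_iff_floor, ← h.cover]
      simp only [Set.mem_iUnion, mem_region_combOfSlot, exists_prop]
      constructor
      · rintro ⟨p, hp, hx, h1⟩
        exact ⟨hx, p, hp, h1⟩
      · rintro ⟨hx, p, hp, h1⟩
        exact ⟨p, hp, hx, h1⟩

namespace IsCombTiling

variable {m₁ m₂ a b : ℕ} {T : Set PlacedComb}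

/-- Two teeth of a tiling that meet start at the same point. -/
theorem tooth_eq (h : IsCombTiling m₁ m₂ a b T) {p q : PlacedComb} (hp : p ∈ T) (hq : q ∈ T)
    {i j : ℕ} (hi : i < p.teeth) (hj : j < q.teeth) {x : ℝ}
    (hx : p.pos + i ≤ x) (hx' : x < p.pos + i + 1 / 2)
    (hy : q.pos + j ≤ x) (hy' : x < q.pos + j + 1 / 2) : p.pos + i = q.pos + j := by
  have hpq : p = q := by
    by_contra hne
    exact Set.disjoint_left.1 (h.disjoint p hp q hq hne)
      (PlacedComb.mem_region.2 ⟨i, hi, hx, hx'⟩) (PlacedComb.mem_region.2 ⟨j, hj, hy, hy'⟩)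
  subst hpq
  -- Distinct teeth of one comb start at least 1 apart, so they cannot meet.
  have h1 : (i : ℝ) < j + 1 := by linarith
  have h2 : (j : ℝ) < i + 1 := by linarith
  have h3 : i < j + 1 := by exact_mod_cast h1
  have h4 : j < i + 1 := by exact_mod_cast h2
  rw [show i = j by omega]

/-- Every half cell of the board is exactly a tooth. -/
theorem exists_tooth (h : IsCombTiling m₁ m₂ 0 b T) :
    ∀ k : ℕ, k < 2 * b → ∃ p ∈ T, ∃ j < p.teeth, p.pos + j = (k : ℝ) / 2 := by
  have hcover : ∀ x : ℝ, x ∈ Set.Ico (0 : ℝ) b ↔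
      ∃ p ∈ T, ∃ j < p.teeth, p.pos + j ≤ x ∧ x < p.pos + j + 1 / 2 := by
    intro x
    have h1 := Set.ext_iff.1 h.cover x
    simp only [Set.mem_iUnion, PlacedComb.mem_region, exists_prop, Nat.cast_zero] at h1
    exact h1.symm
  intro k hk
  induction k with
  | zero =>
    have hb : (0 : ℝ) < b := by
      have : 0 < b := by omega
      exact_mod_cast this
    obtain ⟨p, hp, j, hj, h1, h2⟩ := (hcover 0).1 ⟨le_rfl, hb⟩
    refine ⟨p, hp, j, hj, ?_⟩
    have := ((hcover (p.pos + j)).2 ⟨p, hp, j, hj, le_rfl, by linarith⟩).1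
    push_cast
    linarith
  | succ k ih =>
    obtain ⟨p, hp, i, hi, hpi⟩ := ih (by omega)
    have hk' : ((k : ℝ) + 1) < 2 * b := by exact_mod_cast hk
    obtain ⟨q, hq, j, hj, h1, h2⟩ := (hcover (((k + 1 : ℕ) : ℝ) / 2)).1
      ⟨by positivity, by push_cast; linarith⟩
    refine ⟨q, hq, j, hj, h1.antisymm ?_⟩
    push_cast at h1 h2 ⊢
    by_contra! hlt
    -- A tooth starting before `(k + 1) / 2` and covering that point would meet the tooth on the
    -- previous half cell; both would then start at `k / 2`, and the tooth would end too early.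
    have := h.tooth_eq hp hq hi hj (x := max (p.pos + i) (q.pos + j)) (le_max_left _ _)
      (max_lt (by linarith) (by linarith)) (le_max_right _ _)
      (max_lt (by linarith) (by linarith))
    linarith

/-- All tiles of a tiling start at half-integers. -/
theorem eq_image (h : IsCombTiling m₁ m₂ 0 b T) (h₁ : 0 < m₁) (h₂ : 0 < m₂) :
    ∃ S, T = combOfSlot '' S := by
  refine ⟨combOfSlot ⁻¹' T, (Set.image_preimage_eq_of_subset ?_).symm⟩
  intro p hp
  have ht : 0 < p.teeth := by rcases h.teeth_mem p hp with h1 | h1 <;> omega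
  have hmem : p.pos ∈ p.region := PlacedComb.mem_region.2 ⟨0, ht, by simp, by simp⟩
  have hIco : p.pos ∈ Set.Ico ((0 : ℕ) : ℝ) b := by
    rw [← h.cover]
    exact Set.mem_biUnion hp hmem
  have hpos : 0 ≤ p.pos := by simpa using hIco.1
  have hfloor := (mem_Ico_iff_floor.1 hIco).2.2
  -- The half cell containing `p.pos` is exactly a tooth, which meets the first tooth of `p` and so
  -- starts where `p` does.
  obtain ⟨q, hq, j, hj, h1⟩ := h.exists_tooth _ hfloor
  have h2 := Nat.floor_le (show 0 ≤ 2 * p.pos by linarith)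
  have h3 := Nat.lt_floor_add_one (2 * p.pos)
  have h4 := h.tooth_eq hp hq ht hj (x := p.pos) (by simp) (by simp) (by linarith) (by linarith)
  refine ⟨(p.teeth, ⌊2 * p.pos⌋₊), PlacedComb.ext rfl ?_⟩
  simp only [combOfSlot]
  rw [← h1, ← h4]
  simp

end IsCombTiling

/-! ### Splitting, and mixed metatiles as staggered sets. -/

namespace IsSlotTiling

variable {m l : ℕ} {S : Set (ℕ × ℕ)}

/-- A tiling splits at a cell boundary exactly when no long comb straddles that boundary. -/
theorem splits_iff (hS : IsSlotTiling m 0 l S) {j : ℕ} (hj : j ≤ l) :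
    (∃ S' ⊆ S, IsSlotTiling m 0 j S' ∧ IsSlotTiling m j l (S \ S')) ↔
      ∀ k, (m + 2, k) ∈ S → k < 2 * j → k + 2 * m + 2 < 2 * j := by
  have hfirst : ∀ k, SlotCovers (m + 2, k) k := fun k => slotCovers_self (Nat.succ_pos _)
  have hlast : ∀ k, SlotCovers (m + 2, k) (k + 2 * m + 2) := fun k =>
    ⟨m + 1, Nat.lt_succ_self _, by ring⟩
  constructor
  · rintro ⟨S', -, h1, h2⟩ k hk hkj
    by_cases hk' : (m + 2, k) ∈ S'
    · have := (h1.cover _).1 ⟨_, hk', hlast k⟩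
      omega
    · have := (h2.cover _).1 ⟨_, ⟨hk, hk'⟩, hfirst k⟩
      omega
  · intro h
    have hlt : ∀ p ∈ S, ∀ i, SlotCovers p i → (p.2 < 2 * j ↔ i < 2 * j) := by
      rintro ⟨t, k⟩ hp i ⟨r, hr, rfl⟩
      rcases hS.teeth_mem _ hp with h1 | h1 <;> obtain rfl : t = _ := h1
      · simp only at hr ⊢
        omega
      · have := h k hp
        simp only at hr ⊢
        omega
    -- By `hlt` every tile lies wholly on the side of the boundary where it starts.
    refine ⟨{p ∈ S | p.2 < 2 * j}, fun p hp => hp.1, ?_, ?_⟩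
    · refine ⟨fun p hp => hS.teeth_mem p hp.1, fun p hp q hq => hS.eq_of_covers p hp.1 q hq.1,
        fun i => ?_⟩
      constructor
      · rintro ⟨p, ⟨hp, hpj⟩, hi⟩
        have := (hlt p hp i hi).1 hpj
        omega
      · rintro ⟨-, hi⟩
        obtain ⟨p, hp, h1⟩ := (hS.cover i).2 (by omega)
        exact ⟨p, ⟨hp, (hlt p hp i h1).2 hi⟩, h1⟩
    · refine ⟨fun p hp => hS.teeth_mem p hp.1, fun p hp q hq => hS.eq_of_covers p hp.1 q hq.1,
        fun i => ?_⟩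
      constructor
      · rintro ⟨p, ⟨hp, hpj⟩, hi⟩
        have h1 := (hS.cover i).1 ⟨p, hp, hi⟩
        have h2 : ¬ p.2 < 2 * j := fun h3 => hpj ⟨hp, h3⟩
        rw [hlt p hp i hi] at h2
        omega
      · rintro ⟨h1, h2⟩
        obtain ⟨p, hp, h3⟩ := (hS.cover i).2 (by omega)
        refine ⟨p, ⟨hp, fun h4 => ?_⟩, h3⟩
        have := (hlt p hp i h3).1 h4.2
        omega

end IsSlotTiling

theorem isMetatile_image_iff {m l : ℕ} {S : Set (ℕ × ℕ)} :
    IsMetatile 1 (m + 2) l (combOfSlot '' S) ↔ 0 < l ∧ IsSlotTiling m 0 l S ∧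
      ∀ j, 0 < j → j < l → ∃ k, (m + 2, k) ∈ S ∧ k < 2 * j ∧ 2 * j ≤ k + 2 * m + 2 := by
  have hsplit : ∀ j, (∃ T ⊆ combOfSlot '' S, IsCombTiling 1 (m + 2) 0 j T ∧
      IsCombTiling 1 (m + 2) j l (combOfSlot '' S \ T)) ↔
        ∃ S' ⊆ S, IsSlotTiling m 0 j S' ∧ IsSlotTiling m j l (S \ S') := by
    intro j
    constructor
    · rintro ⟨T, hT, h1, h2⟩
      obtain ⟨S', hS', rfl⟩ := Set.subset_image_iff.1 hT
      rw [← Set.image_sdiff combOfSlot_injective] at h2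
      exact ⟨S', hS', isCombTiling_image_iff.1 (by exact_mod_cast h1),
        isCombTiling_image_iff.1 h2⟩
    · rintro ⟨S', hS', h1, h2⟩
      refine ⟨combOfSlot '' S', Set.image_mono hS', isCombTiling_image_iff.2 h1, ?_⟩
      rw [← Set.image_sdiff combOfSlot_injective]
      exact isCombTiling_image_iff.2 h2
  constructor
  · rintro ⟨hpos, ht, hns⟩
    have hS := isCombTiling_image_iff.1 ht
    refine ⟨hpos, hS, fun j h0 hj => ?_⟩
    by_contra! h
    exact hns ⟨j, h0, hj, (hsplit j).2 ((hS.splits_iff hj.le).2 fun k hk hkj => h k hk hkj)⟩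
  · rintro ⟨hpos, hS, h⟩
    refine ⟨hpos, isCombTiling_image_iff.2 hS, ?_⟩
    rintro ⟨j, h0, hj, hj'⟩
    obtain ⟨k, hk, h1, h2⟩ := h j h0 hj
    have := (hS.splits_iff hj.le).1 ((hsplit j).1 hj') k hk h1
    omega

/-- The left ends of the long combs of a mixed metatile form a staggered set. -/
theorem isStaggered_of_isMixedMetatile {m l : ℕ} {S : Set (ℕ × ℕ)}
    (h : IsMixedMetatile 1 (m + 2) l (combOfSlot '' S)) :
    IsStaggered m l {k | (m + 2, k) ∈ S} := by
  obtain ⟨hM, hmix⟩ := h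
  obtain ⟨hpos, hS, hstr⟩ := isMetatile_image_iff.1 hM
  have hfits : ∀ k, (m + 2, k) ∈ S → k + 2 * m + 2 < 2 * l := by
    intro k hk
    exact ((hS.cover _).1 ⟨_, hk, m + 1, Nat.lt_succ_self _, by ring⟩).2
  have hapart : ∀ k, (m + 2, k) ∈ S → ∀ k', (m + 2, k') ∈ S → k < k' → k % 2 = k' % 2 →
      k + 2 * m + 4 ≤ k' := by
    intro k hk k' hk' hlt hpar
    by_contra! hlt'
    have := hS.eq_of_covers _ hk _ hk' k' ⟨(k' - k) / 2, by simp only; omega,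
      by simp only; omega⟩ (slotCovers_self (Nat.succ_pos _))
    simp only [Prod.mk.injEq, true_and] at this
    omega
  refine ⟨hfits, hapart, hstr, fun s h1 h2 => ?_⟩
  replace h1 : (m + 2, 2 * s) ∈ S := h1
  replace h2 : (m + 2, 2 * s + 1) ∈ S := h2
  -- Two left ends in one cell leave no room for a comb straddling the boundary on the left of the
  -- pair, nor, below, the one on its right. The pair is therefore the whole board and excludes
  -- half-squares, against mixedness.
  have hs : s = 0 := by
    by_contra hs0
    have := hfits _ h1
    obtain ⟨k, hk, hk1, hk2⟩ := hstr s (by omega) (by omega)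
    have h3 := hapart k hk _ h1 (by omega)
    have h4 := hapart k hk _ h2 (by omega)
    omega
  subst hs
  have hl : l = m + 2 := by
    by_contra hne
    have := hfits _ h1
    obtain ⟨k, hk, hk1, hk2⟩ := hstr (m + 2) (by omega) (by omega)
    have h3 := hapart _ h1 k hk (by omega)
    have h4 := hapart _ h2 k hk (by omega)
    omega
  have hall : ∀ p ∈ S, p.1 = m + 2 := by
    intro p hp
    have hself := hS.slotCovers_snd hp
    have hlt := ((hS.cover p.2).1 ⟨p, hp, hself⟩).2
    rcases Nat.mod_two_eq_zero_or_one p.2 with h0 | h0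
    · rw [hS.eq_of_covers p hp _ h1 p.2 hself
        ⟨p.2 / 2, by simp only; omega, by simp only; omega⟩]
    · rw [hS.eq_of_covers p hp _ h2 p.2 hself
        ⟨p.2 / 2, by simp only; omega, by simp only; omega⟩]
  obtain ⟨_, ⟨p, hp, rfl⟩, _, ⟨q, hq, rfl⟩, hne⟩ := hmix
  exact hne ((hall p hp).trans (hall q hq).symm)

/-- The long combs with the given left ends, together with half-squares in all half cells of the
board that these leave free. -/
def fillIn (m l : ℕ) (C : Set ℕ) : Set (ℕ × ℕ) :=
  {p | (p.1 = m + 2 ∧ p.2 ∈ C) ∨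
    (p.1 = 1 ∧ p.2 < 2 * l ∧ ∀ k ∈ C, ¬ SlotCovers (m + 2, k) p.2)}

theorem long_mem_fillIn {m l k : ℕ} {C : Set ℕ} : (m + 2, k) ∈ fillIn m l C ↔ k ∈ C := by
  simp [fillIn]

theorem fillIn_injective (m l : ℕ) : Function.Injective (fillIn m l) := fun C D h => by
  ext k
  rw [← long_mem_fillIn (m := m) (l := l), h, long_mem_fillIn]

theorem slotCovers_one {k i : ℕ} : SlotCovers (1, k) i ↔ i = k := by
  simp [SlotCovers]

/-- A half cell missed by all long combs can only be covered by a half-square starting there. -/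
theorem IsSlotTiling.eq_fillIn {m l : ℕ} {S : Set (ℕ × ℕ)} (hS : IsSlotTiling m 0 l S) :
    S = fillIn m l {k | (m + 2, k) ∈ S} := by
  ext ⟨t, k⟩
  constructor
  · intro hp
    rcases hS.teeth_mem _ hp with h | h <;> obtain rfl : t = _ := h
    · refine Or.inr ⟨rfl, ((hS.cover k).1 ⟨_, hp, hS.slotCovers_snd hp⟩).2, fun k' hk' h => ?_⟩
      have := hS.eq_of_covers _ hp _ hk' k (hS.slotCovers_snd hp) h
      simp at this
    · exact Or.inl ⟨rfl, hp⟩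
  · rintro (⟨rfl : t = _, h⟩ | ⟨rfl : t = _, h1, h2⟩)
    · exact h
    · obtain ⟨⟨t, k'⟩, hp, hk⟩ := (hS.cover k).2 (by simpa using h1)
      rcases hS.teeth_mem _ hp with h | h <;> obtain rfl : t = _ := h
      · obtain rfl := slotCovers_one.1 hk
        exact hp
      · exact absurd hk (h2 k' hp)

theorem IsStaggered.isSlotTiling_fillIn {m l : ℕ} {C : Set ℕ} (hC : IsStaggered m l C) :
    IsSlotTiling m 0 l (fillIn m l C) where
  teeth_mem := by
    rintro p (h | h)
    · exact Or.inr h.1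
    · exact Or.inl h.1
  eq_of_covers := by
    rintro ⟨t, k⟩ (⟨rfl : t = _, h⟩ | ⟨rfl : t = _, h, h'⟩) ⟨t', k'⟩
      (⟨rfl : t' = _, g⟩ | ⟨rfl : t' = _, g, g'⟩) i hi hi'
    · obtain ⟨r, hr, rfl⟩ := hi
      obtain ⟨r', hr', h1⟩ := hi'
      simp only at h g hr hr' h1
      have h2 := hC.apart k h k' g
      have h3 := hC.apart k' g k h
      rw [show k = k' by omega]
    · obtain rfl := slotCovers_one.1 hi'
      exact absurd hi (g' k h)
    · obtain rfl := slotCovers_one.1 hi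
      exact absurd hi' (h' k' g)
    · rw [← slotCovers_one.1 hi, ← slotCovers_one.1 hi']
  cover := by
    intro i
    constructor
    · rintro ⟨⟨t, k⟩, ⟨rfl : t = _, h⟩ | ⟨rfl : t = _, h, -⟩, hi⟩
      · obtain ⟨r, hr, rfl⟩ := hi
        have := hC.fits k h
        simp only at hr ⊢
        omega
      · obtain rfl := slotCovers_one.1 hi
        exact ⟨by omega, h⟩
    · rintro ⟨-, hi⟩
      by_cases h : ∃ k ∈ C, SlotCovers (m + 2, k) i
      · obtain ⟨k, hk, hki⟩ := h
        exact ⟨_, long_mem_fillIn.2 hk, hki⟩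
      · exact ⟨(1, i), Or.inr ⟨rfl, hi, fun k hk hki => h ⟨k, hk, hki⟩⟩, slotCovers_one.2 rfl⟩

theorem IsStaggered.isMixedMetatile {m l : ℕ} {C : Set ℕ} (hC : IsStaggered m l C) (hl : 1 < l) :
    IsMixedMetatile 1 (m + 2) l (combOfSlot '' fillIn m l C) := by
  refine ⟨isMetatile_image_iff.2 ⟨by omega, hC.isSlotTiling_fillIn, fun j h0 hj => ?_⟩, ?_⟩
  · obtain ⟨k, hk, h⟩ := hC.straddled j h0 hj
    exact ⟨k, long_mem_fillIn.2 hk, h⟩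
  · obtain ⟨k, hk, hk1, -⟩ := hC.straddled 1 one_pos hl
    -- Here `k` is 0 or 1 and `1 - k` is the other half of the first cell. A long comb covering it
    -- would have to start there, which `not_both` forbids, so it holds a half-square.
    refine ⟨_, ⟨_, long_mem_fillIn.2 hk, rfl⟩, combOfSlot (1, 1 - k), ⟨_, Or.inr ⟨rfl, ?_, ?_⟩, rfl⟩,
      by simp [combOfSlot]⟩
    · simp only
      omega
    · rintro k' hk' ⟨r, hr, h⟩
      simp only at h
      obtain ⟨rfl, rfl⟩ | ⟨rfl, rfl⟩ : (k = 0 ∧ k' = 1) ∨ (k = 1 ∧ k' = 0) := by omega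
      · exact hC.not_both 0 hk hk'
      · exact hC.not_both 0 hk' hk

theorem numMixedMetatiles_eq_encard (m l : ℕ) (hl : 1 < l) :
    numMixedMetatiles 1 (m + 2) l = {C | IsStaggered m l C}.encard := by
  have himage : {T | IsMixedMetatile 1 (m + 2) l T} =
      (fun C => combOfSlot '' fillIn m l C) '' {C | IsStaggered m l C} := by
    ext T
    constructor
    · intro hT
      obtain ⟨S, rfl⟩ := IsCombTiling.eq_image (by exact_mod_cast hT.1.tiling) one_pos
        (Nat.succ_pos (m + 1))
      refine ⟨_, isStaggered_of_isMixedMetatile hT, ?_⟩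
      simp only
      rw [← (isMetatile_image_iff.1 hT.1).2.1.eq_fillIn]
    · rintro ⟨C, hC, rfl⟩
      exact IsStaggered.isMixedMetatile hC hl
  rw [numMixedMetatiles, himage, Set.InjOn.encard_image]
  exact (combOfSlot_injective.image_injective.comp (fillIn_injective m l)).injOn

theorem theorem3 (m l : ℕ) (hl : 1 < l) :
    numMixedMetatiles 1 (m + 2) l
        = ((2 * (toeplitz01 (l - 1) {-2, -1, (m : ℤ)}).permanent : ℕ) : ℕ∞) ∧
      (toeplitz01 (l - 1) {-2, -1, (m : ℤ)}).permanent
        = numRestrictedPerms (l - 1) {-2, -1, (m : ℤ)} := by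
  refine ⟨?_, permanent_toeplitz01 _ _⟩
  rw [numMixedMetatiles_eq_encard m l hl, encard_isStaggered m l hl, encard_isExcedanceSet,
    permanent_toeplitz01]
  push_cast
  rfl
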